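/- **Fano inequalities for guessing and entanglement recovery.** All systems are finite-dimensional and $\log=\log_2$, with the convention $0\log 0=0$ (so a term $(1-p)\log(n-1)$ with $n=p=1$ is $0$). For a state (density operator) $\rho_{AB}$ let $$H(A|B)_\rho:=\log|A|-D(\rho_{AB},\pi_A\otimes\rho_B),\qquad D(\rho,\sigma)=\mathrm{Tr}[\rho(\log\rho-\log\sigma)],$$ where $|A|$ is the dimension of $A$, $\pi_A=\mathbb 1_A/|A|$, $\rho_B=\mathrm{Tr}_A\rho_{AB}$, and the logarithms of operators are taken on their supports; equivalently $H(A|B)_\rho=S(\rho_{AB})-S(\rho_B)$ with $S$ the von Neumann entropy. Let $h_2(x)=-x\log x-(1-x)\log(1-x)$. 1. Let $p$ be a probability distribution on a finite set $X$, let $(\varphi_x)_{x\in X}$ be states on $B$, and let $\rho_{XB}=\sum_x p_x|x\rangle\langle x|\otimes\varphi_x$. Let $$P_{\rm opt}(X|B)_\rho=\sup_{\Lambda}\sum_x p_x\,\mathrm{Tr}[\varphi_x\Lambda_x],$$ the supremum being over all POVMs $\Lambda=(\Lambda_x)_{x\in X}$ on $B$. Then $$H(X|B)_\rho\le(1-P_{\rm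 opt}(X|B)_\rho)\log(|X|-1)+h_2(P_{\rm opt}(X|B)_\rho).$$ 2. Let $\rho_{AB}$ be an arbitrary bipartite state, and let $$R_{\rm opt}(A|B)_\rho=\sup_{\mathcal E}\mathrm{Tr}[\Phi_{AA'}\,(\mathrm{id}_A\otimes\mathcal E)(\rho_{AB})],$$ the supremum being over all quantum channels (completely positive trace-preserving maps) $\mathcal E$ from $B$ to $A'\simeq A$, where $\Phi_{AA'}=|\Phi\rangle\langle\Phi|$ and $|\Phi\rangle=|A|^{-1/2}\sum_x|x\rangle_A|x\rangle_{A'}$. Then $$H(A|B)_\rho\le-\log|A|+(1-R_{\rm opt}(A|B)_\rho)\log(|A|^2-1)+h_2(R_{\rm opt}(A|B)_\rho).$$ -/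

import Mathlib

open scoped Kronecker Matrix ComplexOrder

namespace QInfo

noncomputable section

/-- `ρ` is a density matrix (a normalized state): positive semidefinite with unit trace. -/
def IsState {n : Type*} [Fintype n] (ρ : Matrix n n ℂ) : Prop :=
  ρ.PosSemidef ∧ ρ.trace = 1

/-- The completely mixed state `π_A = 𝟙 / |A|`. -/
def mixed (A : Type*) [Fintype A] [DecidableEq A] : Matrix A A ℂ :=
  ((Fintype.card A : ℂ)⁻¹) • (1 : Matrix A A ℂ)

/-- The reduced state `ρ_B = Tr_A ρ_{AB}`. -/
def reduceRight {A B : Type*} [Fintype A] (ρ : Matrix (A × B) (A × B) ℂ) : Matrix B B ℂ :=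
  Matrix.of fun b b' => ∑ a, ρ (a, b) (a, b')

/-- The base-two logarithm of a Hermitian matrix, by functional calculus. As `Real.logb 2 0 = 0`,
it vanishes on the kernel (the usual convention of taking the logarithm on the support). -/
def matLog {n : Type*} [Fintype n] [DecidableEq n] (ρ : Matrix n n ℂ) : Matrix n n ℂ :=
  cfc (Real.logb 2) ρ

/-- The quantum relative entropy `D(ρ, σ) = Tr[ρ (log ρ - log σ)]`, i.e. the order-one divergence,
in bits. This formula is the relative entropy when the support of `ρ` lies in that of `σ`; below it
is used only for `σ = π_A ⊗ ρ_B` and `ρ = ρ_{AB}`, where this is always the case. -/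
def relEntropy {n : Type*} [Fintype n] [DecidableEq n] (ρ σ : Matrix n n ℂ) : ℝ :=
  (ρ * (matLog ρ - matLog σ)).trace.re

/-- The conditional entropy `H(A|B)_ρ = log |A| - D(ρ_{AB}, π_A ⊗ ρ_B)`, in bits. It equals
`S(ρ_{AB}) - S(ρ_B)`, see `condEntropy_eq`. -/
def condEntropy {A B : Type*} [Fintype A] [DecidableEq A] [Fintype B] [DecidableEq B]
    (ρ : Matrix (A × B) (A × B) ℂ) : ℝ :=
  Real.logb 2 (Fintype.card A) - relEntropy ρ (mixed A ⊗ₖ reduceRight ρ)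

/-- The von Neumann entropy `S(ρ) = -Tr[ρ log ρ]`, in bits. -/
def vonNeumannEntropy {n : Type*} [Fintype n] [DecidableEq n] (ρ : Matrix n n ℂ) : ℝ :=
  -(ρ * matLog ρ).trace.re

/-- The binary entropy `h₂`, in bits. -/
def h2 (x : ℝ) : ℝ := -x * Real.logb 2 x - (1 - x) * Real.logb 2 (1 - x)

/-- The classical-quantum state `∑ₓ pₓ |x⟩⟨x| ⊗ φₓ` of an ensemble. -/
def cqState {X B : Type*} [Fintype X] [DecidableEq X] (p : X → ℝ) (φ : X → Matrix B B ℂ) :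
    Matrix (X × B) (X × B) ℂ :=
  ∑ x, (p x : ℂ) • (Matrix.single x x (1 : ℂ) ⊗ₖ φ x)

/-- `Λ` is a measurement (POVM) with outcomes in `X`. -/
def IsPOVM {X B : Type*} [Fintype X] [Fintype B] [DecidableEq B]
    (Λ : X → Matrix B B ℂ) : Prop :=
  (∀ x, (Λ x).PosSemidef) ∧ ∑ x, Λ x = 1

/-- The average probability `∑ₓ pₓ Tr[φₓ Λₓ]` of guessing correctly with the measurement `Λ`. -/
def guessProb {X B : Type*} [Fintype X] [Fintype B] (p : X → ℝ) (φ Λ : X → Matrix B B ℂ) : ℝ :=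
  ∑ x, p x * (φ x * Λ x).trace.re

/-- The optimal guessing probability `P_opt(X|B)`: the supremum over all measurements. -/
def guessProbOpt {X B : Type*} [Fintype X] [Fintype B] [DecidableEq B]
    (p : X → ℝ) (φ : X → Matrix B B ℂ) : ℝ :=
  sSup {r | ∃ Λ : X → Matrix B B ℂ, IsPOVM Λ ∧ r = guessProb p φ Λ}

/-- `id_K ⊗ E`, applied to a matrix on `K × B`. -/
def applyRight {K B C : Type*} (E : Matrix B B ℂ →ₗ[ℂ] Matrix C C ℂ)
    (M : Matrix (K × B) (K × B) ℂ) : Matrix (K × C) (K × C) ℂ :=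
  Matrix.of fun i j => E (Matrix.of fun b b' => M (i.1, b) (j.1, b')) i.2 j.2

/-- `E` is a quantum channel: a completely positive and trace-preserving linear map. -/
def IsChannel {B C : Type*} [Fintype B] [Fintype C]
    (E : Matrix B B ℂ →ₗ[ℂ] Matrix C C ℂ) : Prop :=
  (∀ (k : ℕ) (M : Matrix (Fin k × B) (Fin k × B) ℂ), M.PosSemidef → (applyRight E M).PosSemidef) ∧
    ∀ M : Matrix B B ℂ, (E M).trace = M.trace

/-- The maximally entangled vector `|Φ⟩ = |A|^{-1/2} ∑ₓ |x⟩|x⟩`. -/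
def maxEntVec (A : Type*) [Fintype A] [DecidableEq A] : A × A → ℂ :=
  fun i => if i.1 = i.2 then (((Real.sqrt (Fintype.card A))⁻¹ : ℝ) : ℂ) else 0

/-- The maximally entangled state `Φ = |Φ⟩⟨Φ|`. -/
def maxEnt (A : Type*) [Fintype A] [DecidableEq A] : Matrix (A × A) (A × A) ℂ :=
  Matrix.vecMulVec (maxEntVec A) (star (maxEntVec A))

/-- The recovered entanglement fidelity `Tr[Φ (id_A ⊗ E)(ρ_{AB})]` of a map `E` from `B` to a copy
of `A`. -/
def recovery {A B : Type*} [Fintype A] [DecidableEq A]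
    (ρ : Matrix (A × B) (A × B) ℂ) (E : Matrix B B ℂ →ₗ[ℂ] Matrix A A ℂ) : ℝ :=
  (maxEnt A * applyRight E ρ).trace.re

/-- The optimal recovery fidelity `R_opt(A|B)_ρ`: the supremum over all channels. -/
def recoveryOpt {A B : Type*} [Fintype A] [DecidableEq A] [Fintype B]
    (ρ : Matrix (A × B) (A × B) ℂ) : ℝ :=
  sSup {r | ∃ E : Matrix B B ℂ →ₗ[ℂ] Matrix A A ℂ, IsChannel E ∧ r = recovery ρ E}

/-- `M ↦ 𝟙_A ⊗ M` as a star homomorphism. -/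
def oneKron (A B : Type*) [Fintype A] [DecidableEq A] [Fintype B] [DecidableEq B] :
    Matrix B B ℂ →⋆ₐ[ℂ] Matrix (A × B) (A × B) ℂ where
  toFun M := (1 : Matrix A A ℂ) ⊗ₖ M
  map_one' := by simp
  map_mul' M N := by rw [← Matrix.mul_kronecker_mul, one_mul]
  map_zero' := by simp
  map_add' M N := by rw [Matrix.kronecker_add]
  commutes' r := by
    rw [Algebra.algebraMap_eq_smul_one, Matrix.kronecker_smul, Matrix.one_kronecker_one,
      Algebra.algebraMap_eq_smul_one]
  map_star' M := by
    simp [Matrix.star_eq_conjTranspose, Matrix.conjTranspose_kronecker]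

theorem trace_mul_one_kron {A B : Type*} [Fintype A] [DecidableEq A] [Fintype B]
    (ρ : Matrix (A × B) (A × B) ℂ) (M : Matrix B B ℂ) :
    (ρ * ((1 : Matrix A A ℂ) ⊗ₖ M)).trace = (reduceRight ρ * M).trace := by
  have h : ∀ (a : A) (b : B),
      ∑ a', ∑ b', ρ (a, b) (a', b') * ((if a' = a then 1 else 0) * M b' b) =
        ∑ b', ρ (a, b) (a, b') * M b' b := by
    intro a b
    rw [Finset.sum_eq_single a]
    · simp
    · intro a' _ ha'
      simp [ha']
    · simp
  simp only [Matrix.trace, Matrix.diag, Matrix.mul_apply, reduceRight, Matrix.of_apply,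
    Fintype.sum_prod_type, Matrix.kroneckerMap_apply, Matrix.one_apply, Finset.sum_mul, h]
  rw [Finset.sum_comm]
  exact Finset.sum_congr rfl fun b _ => Finset.sum_comm

theorem reduceRight_trace {A B : Type*} [Fintype A] [Fintype B]
    (ρ : Matrix (A × B) (A × B) ℂ) : (reduceRight ρ).trace = ρ.trace := by
  simp only [Matrix.trace, Matrix.diag, reduceRight, Matrix.of_apply, Fintype.sum_prod_type]
  exact Finset.sum_comm

theorem reduceRight_isHermitian {A B : Type*} [Fintype A]
    (ρ : Matrix (A × B) (A × B) ℂ) (hρ : ρ.IsHermitian) : (reduceRight ρ).IsHermitian := by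
  ext b b'
  simp only [Matrix.conjTranspose_apply, reduceRight, Matrix.of_apply, star_sum]
  exact Finset.sum_congr rfl fun a _ => hρ.apply (a, b) (a, b')

theorem condEntropy_eq {A B : Type*} [Fintype A] [DecidableEq A] [Fintype B] [DecidableEq B]
    (ρ : Matrix (A × B) (A × B) ℂ) (hρ : IsState ρ) :
    condEntropy ρ = vonNeumannEntropy ρ - vonNeumannEntropy (reduceRight ρ) := by
  have hA : Nonempty A := by
    by_contra hA
    rw [not_nonempty_iff] at hA
    have h := hρ.2
    simp [Matrix.trace] at h
  have hd : (Fintype.card A : ℝ) ≠ 0 := by exact_mod_cast Fintype.card_ne_zero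
  set d : ℝ := (Fintype.card A : ℝ) with hd_def
  set R := reduceRight ρ with hR
  have hsa : IsSelfAdjoint R := reduceRight_isHermitian ρ hρ.1.isHermitian
  have hfin : (spectrum ℝ R).Finite := Matrix.finite_real_spectrum
  have hc : ∀ f : ℝ → ℝ, ContinuousOn f (spectrum ℝ R) := fun f => hfin.continuousOn f
  have hcont : Continuous (oneKron A B) :=
    LinearMap.continuous_of_finiteDimensional (oneKron A B).toAlgHom.toLinearMap
  have hmix : mixed A ⊗ₖ R = oneKron A B (cfc (fun x : ℝ => d⁻¹ * x) R) := by
    rw [cfc_const_mul_id d⁻¹ R hsa]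
    ext i j
    simp [mixed, oneKron, Matrix.kroneckerMap_apply, hd_def]
    ring
  have hsa' : IsSelfAdjoint (cfc (fun x : ℝ => d⁻¹ * x) R) := cfc_predicate _ _
  have hfin' : (spectrum ℝ (cfc (fun x : ℝ => d⁻¹ * x) R)).Finite := Matrix.finite_real_spectrum
  have hlog : matLog (mixed A ⊗ₖ R) =
      (1 : Matrix A A ℂ) ⊗ₖ cfc (fun x : ℝ => Real.logb 2 (d⁻¹ * x)) R := by
    rw [matLog, hmix, ← StarAlgHom.map_cfc (oneKron A B) (Real.logb 2) _ (hfin'.continuousOn _)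
      hcont hsa' (hsa'.map _),
      ← cfc_comp' (Real.logb 2) (fun x : ℝ => d⁻¹ * x) R ((hfin.image _).continuousOn _) (hc _) hsa]
    rfl
  have hmul : R * cfc (fun x : ℝ => Real.logb 2 (d⁻¹ * x)) R =
      R * matLog R - Real.logb 2 d • R := by
    have h1 : ∀ f : ℝ → ℝ, R * cfc f R = cfc (fun x => x * f x) R := fun f => by
      rw [cfc_mul (fun x => x) f R (hc _) (hc _), cfc_id' ℝ R]
    rw [matLog, h1, h1]
    have h2 : Real.logb 2 d • R = cfc (fun x : ℝ => Real.logb 2 d * x) R :=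
      (cfc_const_mul_id _ R hsa).symm
    rw [h2, ← cfc_sub _ _ R (hc _) (hc _)]
    congr 1
    funext x
    by_cases hx : x = 0
    · simp [hx]
    · rw [Real.logb_mul (inv_ne_zero hd) hx, Real.logb_inv]
      ring
  rw [condEntropy, relEntropy, vonNeumannEntropy, vonNeumannEntropy, mul_sub, Matrix.trace_sub,
    hlog, trace_mul_one_kron, ← hR, hmul, Matrix.trace_sub, Matrix.trace_smul, hR,
    reduceRight_trace, hρ.2]
  simp
  ring

end

end QInfo

namespace QInfo

/-! ### Comparing relative entropies through resolvents -/

/-! Both inequalities are data processing for a two-outcome measurement `{T, 1 - T}`. If `T`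
succeeds with probability `p` on `ρ_AB` and `1/m` on `σ = π_A ⊗ ρ_B`, the binary relative entropy of
the outcomes gives `D(ρ, σ) ≥ log m - (1 - p) log (m - 1) - h₂(p)` (`neg_relEntropy_le_of_test`).
For guessing, `T = ∑ₓ |x⟩⟨x| ⊗ Λₓ` and `m = |X|`; for recovery, `T` is `Φ` pulled back through the
channel and `m = |A|²`. In both cases `1/m` does not depend on the strategy. The bound is continuous
in `p`, so it survives the supremum (`le_apply_csSup`).

Data processing (`IsPOVM.sum_mul_logb_le_relEntropy`) rests on an integral representation of the
logarithm: it suffices to compare, for each `t > 0`, the sums of `r² / (s + t r)`. In the eigenbases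
of `ρ` and `σ` the quantum sum dominates `2 Re Tr ρY - Tr σYYᴴ - t Tr ρYᴴY` for every matrix `Y`.
Taking `Y = ∑ cₖ Tₖ` with the classical optimizer `cₖ`, and using `Y² ≤ ∑ cₖ² Tₖ`, recovers the
classical sum. -/

theorem hasDerivAt_mul_log_add_mul {w r s t : ℝ} (hr : 0 ≤ r) (hs : 0 ≤ s)
    (h : w * r ≠ 0 → s ≠ 0) (ht : 0 ≤ t) :
    HasDerivAt (fun t => w * r * (Real.log (s + t * r) - Real.log s))
      (w * (r ^ 2 / (s + t * r))) t := by
  by_cases hwr : w * r = 0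
  -- This is the only case in which `s = 0` is possible; the function is then constantly zero.
  · rcases mul_eq_zero.1 hwr with h0 | h0 <;> simpa [h0] using hasDerivAt_const t (0 : ℝ)
  · have hs' : 0 < s := hs.lt_of_ne' (h hwr)
    have hpos : 0 < s + t * r := by positivity
    have h1 : HasDerivAt (fun t => s + t * r) r t := by
      simpa using ((hasDerivAt_id t).mul_const r).const_add s
    exact (((h1.log hpos.ne').sub_const (Real.log s)).const_mul (w * r)).congr_deriv (by ring)

/-- Since `log (s + t r) - log t = log (s / t + r)`, removing the logarithmic divergence leaves `log
r` in the limit. -/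
theorem tendsto_mul_log_add_mul_sub {w r s : ℝ} (hr : 0 ≤ r) (hs : 0 ≤ s) :
    Filter.Tendsto (fun t => w * r * (Real.log (s + t * r) - Real.log s) - w * r * Real.log t)
      Filter.atTop (nhds (w * r * (Real.log r - Real.log s))) := by
  by_cases hr0 : r = 0
  · simp [hr0]
  have hr' : 0 < r := hr.lt_of_ne' hr0
  have h1 : Filter.Tendsto (fun t : ℝ => s * t⁻¹ + r) Filter.atTop (nhds r) := by
    simpa using (tendsto_inv_atTop_zero.const_mul s).add_const r
  have h2 := ((h1.log hr0).sub_const (Real.log s)).const_mul (w * r)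
  refine h2.congr' ?_
  filter_upwards [Filter.eventually_gt_atTop 0] with t ht
  have h3 : s + t * r = t * (s * t⁻¹ + r) := by field_simp
  have h4 : s * t⁻¹ + r ≠ 0 := by positivity
  rw [h3, Real.log_mul ht.ne' h4]
  ring

/-- Two weighted families of positive pairs whose resolvent sums are ordered for every parameter
have ordered relative entropies: `log (r / s)` is the integral of `r / (s + t r) - 1 / (1 + t)`. -/
theorem sum_mul_log_le_of_resolvent {ι κ : Type*} [Fintype ι] [Fintype κ] {w r s : ι → ℝ}
    {p q : κ → ℝ} (hr : ∀ i, 0 ≤ r i) (hs : ∀ i, 0 ≤ s i) (hrs : ∀ i, w i * r i ≠ 0 → s i ≠ 0)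
    (hp : ∀ k, 0 ≤ p k) (hq : ∀ k, 0 ≤ q k) (hpq : ∀ k, p k ≠ 0 → q k ≠ 0)
    (hsum : ∑ i, w i * r i = ∑ k, p k)
    (hres : ∀ t : ℝ, 0 < t →
      ∑ k, p k ^ 2 / (q k + t * p k) ≤ ∑ i, w i * (r i ^ 2 / (s i + t * r i))) :
    ∑ k, p k * (Real.log (p k) - Real.log (q k)) ≤
      ∑ i, w i * r i * (Real.log (r i) - Real.log (s i)) := by
  set F : ℝ → ℝ := fun t => ∑ i, w i * r i * (Real.log (s i + t * r i) - Real.log (s i)) with hF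
  set G : ℝ → ℝ := fun t => ∑ k, 1 * p k * (Real.log (q k + t * p k) - Real.log (q k)) with hG
  have hFd : ∀ t, 0 ≤ t → HasDerivAt F (∑ i, w i * (r i ^ 2 / (s i + t * r i))) t := fun t ht =>
    HasDerivAt.fun_sum fun i _ => hasDerivAt_mul_log_add_mul (hr i) (hs i) (hrs i) ht
  have hGd : ∀ t, 0 ≤ t → HasDerivAt G (∑ k, 1 * (p k ^ 2 / (q k + t * p k))) t := fun t ht =>
    HasDerivAt.fun_sum fun k _ =>
      hasDerivAt_mul_log_add_mul (hp k) (hq k) (by simpa using hpq k) ht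
  -- The derivative of `F - G` is nonnegative by `hres`, and `F 0 = G 0 = 0`.
  have hmono : MonotoneOn (fun t => F t - G t) (Set.Ici 0) := by
    refine monotoneOn_of_hasDerivWithinAt_nonneg (convex_Ici 0)
      (fun t ht => ((hFd t ht).sub (hGd t ht)).continuousAt.continuousWithinAt)
      (fun t ht => ((hFd t (interior_subset ht)).sub
        (hGd t (interior_subset ht))).hasDerivWithinAt) fun t ht => ?_
    rw [interior_Ici] at ht
    simpa using hres t ht
  have hle : ∀ t, 0 ≤ t → G t ≤ F t := fun t ht => by
    have := hmono (Set.mem_Ici.2 le_rfl) ht ht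
    simp only [hF, hG] at this ⊢
    simpa using this
  have hFl := tendsto_finsetSum (Finset.univ : Finset ι) fun i _ =>
    tendsto_mul_log_add_mul_sub (w := w i) (hr i) (hs i)
  have hGl := tendsto_finsetSum (Finset.univ : Finset κ) fun k _ =>
    tendsto_mul_log_add_mul_sub (w := 1) (hp k) (hq k)
  -- By `hsum` the divergent `log t` terms on the two sides have equal coefficients, so `G ≤ F`
  -- passes to the limits.
  have := le_of_tendsto_of_tendsto hGl hFl (by
    filter_upwards [Filter.eventually_ge_atTop 0] with t ht
    rw [Finset.sum_sub_distrib, Finset.sum_sub_distrib, ← Finset.sum_mul, ← Finset.sum_mul, hsum]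
    simpa [hF, hG] using hle t ht)
  simpa using this

/-! ### Positive semidefinite matrices -/

open scoped MatrixOrder in
theorem exists_conjTranspose_mul_self {n : Type*} [Fintype n] [DecidableEq n] {M : Matrix n n ℂ}
    (hM : M.PosSemidef) : ∃ C : Matrix n n ℂ, M = Cᴴ * C :=
  CStarAlgebra.nonneg_iff_eq_star_mul_self.mp hM.nonneg

theorem trace_mul_nonneg {n : Type*} [Fintype n] [DecidableEq n] {M N : Matrix n n ℂ}
    (hM : M.PosSemidef) (hN : N.PosSemidef) : 0 ≤ (M * N).trace := by
  obtain ⟨C, rfl⟩ := exists_conjTranspose_mul_self hN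
  rw [← mul_assoc, Matrix.trace_mul_comm, ← mul_assoc]
  exact (hM.mul_mul_conjTranspose_same C).trace_nonneg

/-- Writing `M = Kᴴ K`, the trace is the squared Hilbert–Schmidt norm of `K C`. -/
theorem mul_eq_zero_of_trace_mul_mul_conjTranspose {m n : Type*} [Fintype m] [Fintype n]
    [DecidableEq n] {M : Matrix n n ℂ} (hM : M.PosSemidef) (C : Matrix n m ℂ)
    (h : (M * (C * Cᴴ)).trace = 0) : M * C = 0 := by
  obtain ⟨K, rfl⟩ := exists_conjTranspose_mul_self hM
  have h1 : ((K * C)ᴴ * (K * C)).trace = 0 := by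
    rw [← h, Matrix.conjTranspose_mul, ← Matrix.mul_assoc (Kᴴ * K), Matrix.trace_mul_comm _ Cᴴ]
    simp only [Matrix.mul_assoc]
  rw [Matrix.trace_conjTranspose_mul_self_eq_zero_iff] at h1
  rw [Matrix.mul_assoc, h1, Matrix.mul_zero]

theorem mul_eq_zero_of_trace_mul_eq_zero {n : Type*} [Fintype n] [DecidableEq n]
    {M N : Matrix n n ℂ} (hM : M.PosSemidef) (hN : N.PosSemidef) (h : (M * N).trace = 0) :
    M * N = 0 := by
  obtain ⟨C, rfl⟩ := exists_conjTranspose_mul_self hN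
  rw [← mul_assoc, mul_eq_zero_of_trace_mul_mul_conjTranspose hM Cᴴ (by simpa using h), zero_mul]

/-- The kernel inclusion of positive semidefinite matrices passes to traces against effects. -/
theorem trace_mul_eq_zero_of_ker_le {n : Type*} [Fintype n] [DecidableEq n]
    {ρ σ T : Matrix n n ℂ} (hσ : σ.PosSemidef) (hT : T.PosSemidef)
    (hker : ∀ v : n → ℂ, σ *ᵥ v = 0 → ρ *ᵥ v = 0) (h : (σ * T).trace = 0) :
    (ρ * T).trace = 0 := by
  have h0 := mul_eq_zero_of_trace_mul_eq_zero hσ hT h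
  have h1 : ρ * T = 0 := by
    ext i j
    have h2 : σ *ᵥ (fun k => T k j) = 0 := funext fun k => congrFun (congrFun h0 k) j
    exact congrFun (hker _ h2) i
  rw [h1, Matrix.trace_zero]

/-! ### Traces in the eigenbases of two Hermitian matrices -/

section Eigenbases

variable {n : Type*} [Fintype n] [DecidableEq n] {ρ σ : Matrix n n ℂ}

/-- The matrix of `M` with rows in the eigenbasis of `σ` and columns in that of `ρ`. -/
noncomputable def eigenCoord (hρ : ρ.IsHermitian) (hσ : σ.IsHermitian) (M : Matrix n n ℂ) :
    Matrix n n ℂ :=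
  (hσ.eigenvectorUnitary : Matrix n n ℂ)ᴴ * M * (hρ.eigenvectorUnitary : Matrix n n ℂ)

theorem cfc_eq_conj_diagonal (hρ : ρ.IsHermitian) (f : ℝ → ℝ) :
    cfc f ρ = (hρ.eigenvectorUnitary : Matrix n n ℂ) *
      Matrix.diagonal (fun i => (f (hρ.eigenvalues i) : ℂ)) *
        (hρ.eigenvectorUnitary : Matrix n n ℂ)ᴴ := by
  rw [hρ.cfc_eq, Matrix.IsHermitian.cfc, Unitary.conjStarAlgAut_apply]
  rfl

theorem cfc_fun_one (hρ : ρ.IsHermitian) : cfc (fun _ : ℝ => (1 : ℝ)) ρ = 1 := by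
  have hsa : IsSelfAdjoint ρ := hρ
  exact cfc_const_one ℝ ρ hsa

theorem trace_cfc_mul_conjTranspose_mul_cfc_mul (hρ : ρ.IsHermitian) (hσ : σ.IsHermitian)
    (g f : ℝ → ℝ) (M N : Matrix n n ℂ) :
    (cfc g ρ * (Mᴴ * (cfc f σ * N))).trace =
      ∑ i, ∑ j, (g (hρ.eigenvalues i) : ℂ) * (f (hσ.eigenvalues j) : ℂ) *
        (star (eigenCoord hρ hσ M j i) * eigenCoord hρ hσ N j i) := by
  have h : (cfc g ρ * (Mᴴ * (cfc f σ * N))).trace =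
      (Matrix.diagonal (fun i => (g (hρ.eigenvalues i) : ℂ)) * ((eigenCoord hρ hσ M)ᴴ *
        (Matrix.diagonal (fun j => (f (hσ.eigenvalues j) : ℂ)) * eigenCoord hρ hσ N))).trace := by
    rw [cfc_eq_conj_diagonal hρ, cfc_eq_conj_diagonal hσ, eigenCoord, eigenCoord, mul_assoc,
      mul_assoc, Matrix.trace_mul_comm]
    simp only [Matrix.conjTranspose_mul, Matrix.conjTranspose_conjTranspose, mul_assoc]
  rw [h, Matrix.trace]
  refine Finset.sum_congr rfl fun i _ => ?_
  rw [Matrix.diag_apply, Matrix.diagonal_mul, Matrix.mul_apply, Finset.mul_sum]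
  refine Finset.sum_congr rfl fun j _ => ?_
  rw [Matrix.diagonal_mul, Matrix.conjTranspose_apply]
  ring

theorem re_trace_cfc_mul_conjTranspose_mul_cfc_mul (hρ : ρ.IsHermitian) (hσ : σ.IsHermitian)
    (g f : ℝ → ℝ) (M : Matrix n n ℂ) :
    (cfc g ρ * (Mᴴ * (cfc f σ * M))).trace.re =
      ∑ i, ∑ j, g (hρ.eigenvalues i) * f (hσ.eigenvalues j) *
        ‖eigenCoord hρ hσ M j i‖ ^ 2 := by
  rw [trace_cfc_mul_conjTranspose_mul_cfc_mul, Complex.re_sum]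
  refine Finset.sum_congr rfl fun i _ => ?_
  rw [Complex.re_sum]
  refine Finset.sum_congr rfl fun j _ => ?_
  rw [Complex.star_def, Complex.conj_mul', ← Complex.ofReal_mul, ← Complex.ofReal_pow,
    ← Complex.ofReal_mul, Complex.ofReal_re]

/-- The squared overlaps of the two eigenbases act as weights on pairs of eigenvalues, which puts
the quantum quantity in the form required by `sum_mul_log_le_of_resolvent`. -/
theorem relEntropy_eq_sum (hρ : ρ.IsHermitian) (hσ : σ.IsHermitian) :
    relEntropy ρ σ = ∑ i, ∑ j, ‖eigenCoord hρ hσ 1 j i‖ ^ 2 * hρ.eigenvalues i *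
      (Real.logb 2 (hρ.eigenvalues i) - Real.logb 2 (hσ.eigenvalues j)) := by
  have hc : ∀ f : ℝ → ℝ, ContinuousOn f (spectrum ℝ ρ) :=
    fun f => Matrix.finite_real_spectrum.continuousOn f
  have hsa : IsSelfAdjoint ρ := hρ
  -- The identity is inserted as a function of `σ` so that both traces expand over the same pairs of
  -- eigenvalues.
  have h1 : ρ * matLog ρ = cfc (fun x => x * Real.logb 2 x) ρ *
      ((1 : Matrix n n ℂ)ᴴ * (cfc (fun _ => (1 : ℝ)) σ * 1)) := by
    rw [cfc_fun_one hσ, cfc_mul (fun x => x) _ ρ (hc _) (hc _), cfc_id' ℝ ρ, matLog]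
    simp
  have h2 : ρ * matLog σ = cfc (fun x : ℝ => x) ρ *
      ((1 : Matrix n n ℂ)ᴴ * (cfc (Real.logb 2) σ * 1)) := by
    rw [cfc_id' ℝ ρ, matLog]
    simp
  rw [relEntropy, mul_sub, Matrix.trace_sub, Complex.sub_re, h1, h2,
    re_trace_cfc_mul_conjTranspose_mul_cfc_mul hρ hσ,
    re_trace_cfc_mul_conjTranspose_mul_cfc_mul hρ hσ, ← Finset.sum_sub_distrib]
  refine Finset.sum_congr rfl fun i _ => ?_
  rw [← Finset.sum_sub_distrib]
  exact Finset.sum_congr rfl fun j _ => by ring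

theorem sum_eigenvalues_eq_trace (hρ : ρ.IsHermitian) (hσ : σ.IsHermitian) :
    ∑ i, ∑ j, ‖eigenCoord hρ hσ 1 j i‖ ^ 2 * hρ.eigenvalues i = ρ.trace.re := by
  have hsa : IsSelfAdjoint ρ := hρ
  have h : ρ = cfc (fun x : ℝ => x) ρ *
      ((1 : Matrix n n ℂ)ᴴ * (cfc (fun _ => (1 : ℝ)) σ * 1)) := by
    rw [cfc_id' ℝ ρ, cfc_fun_one hσ]
    simp
  conv_rhs => rw [h]
  rw [re_trace_cfc_mul_conjTranspose_mul_cfc_mul hρ hσ]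
  exact Finset.sum_congr rfl fun i _ => Finset.sum_congr rfl fun j _ => by ring

/-- Completing the square: for `r > 0` the left side is maximal at `y = r u / (s + t r)`. -/
theorem two_mul_re_star_mul_le {r s t : ℝ} (hr : 0 ≤ r) (hs : 0 ≤ s) (ht : 0 < t) (u y : ℂ) :
    2 * (r * (star u * y).re) - s * ‖y‖ ^ 2 - t * (r * ‖y‖ ^ 2) ≤
      ‖u‖ ^ 2 * (r ^ 2 / (s + t * r)) := by
  rcases hr.eq_or_lt with rfl | hr
  · have := mul_nonneg hs (sq_nonneg ‖y‖)
    simpa using this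
  have hpos : 0 < s + t * r := by positivity
  have h1 : (star u * y).re ≤ ‖u‖ * ‖y‖ := by
    refine (Complex.re_le_norm _).trans ?_
    rw [norm_mul, norm_star]
  rw [mul_div_assoc', le_div_iff₀ hpos]
  nlinarith [sq_nonneg (r * ‖u‖ - (s + t * r) * ‖y‖),
    mul_le_mul_of_nonneg_left h1 (mul_pos hr hpos).le]

/-- The variational lower bound on the resolvent of the relative modular operator. -/
theorem variational_le_resolvent (hρ : ρ.PosSemidef) (hσ : σ.PosSemidef) {t : ℝ} (ht : 0 < t)
    (Y : Matrix n n ℂ) :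
    2 * (ρ * Y).trace.re - (σ * (Y * Yᴴ)).trace.re - t * (ρ * (Yᴴ * Y)).trace.re ≤
      ∑ i, ∑ j, ‖eigenCoord hρ.1 hσ.1 1 j i‖ ^ 2 *
        (hρ.1.eigenvalues i ^ 2 / (hσ.1.eigenvalues j + t * hρ.1.eigenvalues i)) := by
  have hsρ : IsSelfAdjoint ρ := hρ.1
  have hsσ : IsSelfAdjoint σ := hσ.1
  have h1 : (ρ * Y).trace.re = ∑ i, ∑ j, hρ.1.eigenvalues i *
      (star (eigenCoord hρ.1 hσ.1 1 j i) * eigenCoord hρ.1 hσ.1 Y j i).re := by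
    have h := trace_cfc_mul_conjTranspose_mul_cfc_mul hρ.1 hσ.1 (fun x => x) (fun _ => 1) 1 Y
    rw [cfc_id' ℝ ρ, cfc_fun_one hσ.1] at h
    simp only [Matrix.conjTranspose_one, one_mul] at h
    rw [h, Complex.re_sum]
    refine Finset.sum_congr rfl fun i _ => ?_
    rw [Complex.re_sum]
    refine Finset.sum_congr rfl fun j _ => ?_
    rw [Complex.ofReal_one, mul_one, Complex.re_ofReal_mul]
  have h2 : (σ * (Y * Yᴴ)).trace.re = ∑ i, ∑ j, hσ.1.eigenvalues j *
      ‖eigenCoord hρ.1 hσ.1 Y j i‖ ^ 2 := by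
    have h := re_trace_cfc_mul_conjTranspose_mul_cfc_mul hρ.1 hσ.1 (fun _ => 1) (fun x => x) Y
    rw [cfc_id' ℝ σ, cfc_fun_one hρ.1, one_mul, Matrix.trace_mul_comm, mul_assoc] at h
    simpa using h
  have h3 : (ρ * (Yᴴ * Y)).trace.re = ∑ i, ∑ j, hρ.1.eigenvalues i *
      ‖eigenCoord hρ.1 hσ.1 Y j i‖ ^ 2 := by
    have h := re_trace_cfc_mul_conjTranspose_mul_cfc_mul hρ.1 hσ.1 (fun x => x) (fun _ => 1) Y
    rw [cfc_id' ℝ ρ, cfc_fun_one hσ.1, one_mul] at h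
    simpa using h
  rw [h1, h2, h3]
  simp only [Finset.mul_sum, ← Finset.sum_sub_distrib]
  exact Finset.sum_le_sum fun i _ => Finset.sum_le_sum fun j _ =>
    two_mul_re_star_mul_le (hρ.eigenvalues_nonneg i) (hσ.eigenvalues_nonneg j) ht _ _

/-- If `σ` kills its eigenvector `f`, so does `ρ`, and `rᵢ ⟨f, eᵢ⟩ = ⟨f, ρ eᵢ⟩ = 0`. Thus pairs with
a vanishing eigenvalue of `σ` contribute nothing. -/
theorem eigenvalues_mul_eigenCoord (hρ : ρ.IsHermitian) (hσ : σ.IsHermitian)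
    (hker : ∀ v : n → ℂ, σ *ᵥ v = 0 → ρ *ᵥ v = 0) (i j : n) (hj : hσ.eigenvalues j = 0) :
    ‖eigenCoord hρ hσ 1 j i‖ ^ 2 * hρ.eigenvalues i = 0 := by
  have h1 : σ *ᵥ ⇑(hσ.eigenvectorBasis j) = 0 := by
    rw [hσ.mulVec_eigenvectorBasis, hj, zero_smul]
  have h2 := hker _ h1
  have h3 : star (⇑(hσ.eigenvectorBasis j)) ⬝ᵥ (ρ *ᵥ ⇑(hρ.eigenvectorBasis i)) = 0 := by
    have h5 := Matrix.star_mulVec ρ ⇑(hσ.eigenvectorBasis j)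
    rw [h2, star_zero, hρ.eq] at h5
    rw [Matrix.dotProduct_mulVec, ← h5, zero_dotProduct]
  have h4 : eigenCoord hρ hσ 1 j i =
      star (⇑(hσ.eigenvectorBasis j)) ⬝ᵥ ⇑(hρ.eigenvectorBasis i) := by
    simp [eigenCoord, Matrix.mul_apply, dotProduct, Matrix.IsHermitian.eigenvectorUnitary_apply]
  rw [hρ.mulVec_eigenvectorBasis, dotProduct_smul, ← h4] at h3
  rcases smul_eq_zero.1 h3 with h | h <;> simp [h]

end Eigenbases

/-! ### Data processing for measurements -/

/-- With `Y = ∑ cₖ Tₖ`, the difference is the operator variance `∑ (cₖ - Y) Tₖ (cₖ - Y)`. -/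
theorem IsPOVM.sum_sq_sub_sq_posSemidef {κ n : Type*} [Fintype κ] [Fintype n] [DecidableEq n]
    {T : κ → Matrix n n ℂ} (hT : IsPOVM T) (c : κ → ℝ) :
    (∑ k, (c k : ℂ) ^ 2 • T k -
      (∑ k, (c k : ℂ) • T k) * (∑ k, (c k : ℂ) • T k)).PosSemidef := by
  set Y := ∑ k, (c k : ℂ) • T k with hY
  have hYh : Yᴴ = Y := by
    rw [hY, Matrix.conjTranspose_sum]
    exact Finset.sum_congr rfl fun k _ => by
      rw [Matrix.conjTranspose_smul, (hT.1 k).1.eq]; simp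
  have h : ∑ k, (c k : ℂ) ^ 2 • T k - Y * Y =
      ∑ k, ((c k : ℂ) • 1 - Y) * T k * ((c k : ℂ) • 1 - Y)ᴴ := by
    have h1 : ∀ k, ((c k : ℂ) • 1 - Y) * T k * ((c k : ℂ) • 1 - Y)ᴴ =
        (c k : ℂ) ^ 2 • T k - Y * ((c k : ℂ) • T k) - ((c k : ℂ) • T k) * Y + Y * T k * Y := by
      intro k
      rw [Matrix.conjTranspose_sub, hYh, Matrix.conjTranspose_smul, Matrix.conjTranspose_one,
        Complex.star_def, Complex.conj_ofReal]
      simp only [sub_mul, mul_sub, smul_mul_assoc, mul_smul_comm, one_mul, mul_one, smul_smul, sq,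
        smul_sub]
      abel
    simp only [h1, Finset.sum_add_distrib, Finset.sum_sub_distrib]
    rw [← Finset.mul_sum, ← Finset.sum_mul, ← Finset.sum_mul, ← Finset.mul_sum, hT.2, ← hY]
    simp
  rw [h]
  exact Matrix.posSemidef_sum _ fun k _ => (hT.1 k).mul_mul_conjTranspose_same _

theorem IsPOVM.sum_trace_mul {κ n : Type*} [Fintype κ] [Fintype n] [DecidableEq n]
    {T : κ → Matrix n n ℂ} (hT : IsPOVM T) (ρ : Matrix n n ℂ) :
    ∑ k, (ρ * T k).trace.re = ρ.trace.re := by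
  rw [← Complex.re_sum, ← Matrix.trace_sum, ← Finset.mul_sum, hT.2, mul_one]

/-- The relative entropy does not increase under a measurement. -/
theorem IsPOVM.sum_mul_logb_le_relEntropy {κ n : Type*} [Fintype κ] [Fintype n] [DecidableEq n]
    {ρ σ : Matrix n n ℂ} {T : κ → Matrix n n ℂ} (hT : IsPOVM T) (hρ : ρ.PosSemidef)
    (hσ : σ.PosSemidef) (hker : ∀ v : n → ℂ, σ *ᵥ v = 0 → ρ *ᵥ v = 0) :
    ∑ k, (ρ * T k).trace.re *
      (Real.logb 2 (ρ * T k).trace.re - Real.logb 2 (σ * T k).trace.re) ≤ relEntropy ρ σ := by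
  set p : κ → ℝ := fun k => (ρ * T k).trace.re with hp
  set q : κ → ℝ := fun k => (σ * T k).trace.re with hq
  have hp0 : ∀ k, 0 ≤ p k := fun k => (Complex.le_def.1 (trace_mul_nonneg hρ (hT.1 k))).1
  have hq0 : ∀ k, 0 ≤ q k := fun k => (Complex.le_def.1 (trace_mul_nonneg hσ (hT.1 k))).1
  have hpq : ∀ k, p k ≠ 0 → q k ≠ 0 := by
    intro k hpk hqk
    refine hpk ?_
    have h1 : (σ * T k).trace = 0 :=
      Complex.ext hqk (Complex.le_def.1 (trace_mul_nonneg hσ (hT.1 k))).2.symm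
    simp only [hp]
    rw [trace_mul_eq_zero_of_ker_le hσ (hT.1 k) hker h1, Complex.zero_re]
  have hres : ∀ t : ℝ, 0 < t → ∑ k, p k ^ 2 / (q k + t * p k) ≤
      ∑ i, ∑ j, ‖eigenCoord hρ.1 hσ.1 1 j i‖ ^ 2 *
        (hρ.1.eigenvalues i ^ 2 / (hσ.1.eigenvalues j + t * hρ.1.eigenvalues i)) := by
    intro t ht
    -- This maximizes `2 c pₖ - c² (qₖ + t pₖ)` whenever the denominator is nonzero; the maximum is
    -- `pₖ² / (qₖ + t pₖ)`.
    set c : κ → ℝ := fun k => p k / (q k + t * p k) with hc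
    set Y := ∑ k, (c k : ℂ) • T k with hY
    have hYh : Yᴴ = Y := by
      rw [hY, Matrix.conjTranspose_sum]
      exact Finset.sum_congr rfl fun k _ => by
        rw [Matrix.conjTranspose_smul, (hT.1 k).1.eq]; simp
    have hlin : ∀ (M : Matrix n n ℂ) (d : κ → ℝ),
        (M * ∑ k, (d k : ℂ) • T k).trace.re = ∑ k, d k * (M * T k).trace.re := by
      intro M d
      simp only [Finset.mul_sum, Matrix.trace_sum, Complex.re_sum, Matrix.mul_smul,
        Matrix.trace_smul, smul_eq_mul, Complex.re_ofReal_mul]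
    have hsq : ∀ M : Matrix n n ℂ, M.PosSemidef →
        (M * (Y * Y)).trace.re ≤ ∑ k, c k ^ 2 * (M * T k).trace.re := by
      intro M hM
      have h1 := (Complex.le_def.1 (trace_mul_nonneg hM (hT.sum_sq_sub_sq_posSemidef c))).1
      rw [mul_sub, Matrix.trace_sub, Complex.sub_re] at h1
      have h2 := hlin M (fun k => c k ^ 2)
      push_cast at h2
      rw [h2] at h1
      exact sub_nonneg.1 h1
    have hvar := variational_le_resolvent hρ hσ ht Y
    rw [hYh] at hvar
    refine le_trans ?_ hvar
    have h1 := hsq ρ hρ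
    have h2 := hsq σ hσ
    have h3 : ∑ k, p k ^ 2 / (q k + t * p k) =
        2 * ∑ k, c k * p k - ∑ k, c k ^ 2 * q k - t * ∑ k, c k ^ 2 * p k := by
      simp only [Finset.mul_sum, ← Finset.sum_sub_distrib]
      refine Finset.sum_congr rfl fun k _ => ?_
      -- Here the denominator may vanish too, but both sides are zero.
      by_cases hk : p k = 0
      · simp [hc, hk]
      · have hk' : 0 < p k := (hp0 k).lt_of_ne' hk
        have := hq0 k
        have hne : q k + t * p k ≠ 0 := by positivity
        simp only [hc]
        field_simp
        ring
    rw [h3, hY, hlin]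
    have h4 := mul_le_mul_of_nonneg_left h1 ht.le
    linarith
  have key := sum_mul_log_le_of_resolvent (ι := n × n)
    (w := fun x => ‖eigenCoord hρ.1 hσ.1 1 x.2 x.1‖ ^ 2) (r := fun x => hρ.1.eigenvalues x.1)
    (s := fun x => hσ.1.eigenvalues x.2) (p := p) (q := q)
    (fun x => hρ.eigenvalues_nonneg x.1) (fun x => hσ.eigenvalues_nonneg x.2)
    (fun x hx h0 => hx (eigenvalues_mul_eigenCoord hρ.1 hσ.1 hker x.1 x.2 h0)) hp0 hq0 hpq
    (by rw [Fintype.sum_prod_type, sum_eigenvalues_eq_trace, ← hT.sum_trace_mul ρ])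
    (fun t ht => by rw [Fintype.sum_prod_type]; exact hres t ht)
  rw [Fintype.sum_prod_type] at key
  rw [relEntropy_eq_sum hρ.1 hσ.1]
  have hlog : ∀ a b c : ℝ, a * (Real.logb 2 b - Real.logb 2 c) =
      a * (Real.log b - Real.log c) / Real.log 2 := fun a b c => by
    simp only [Real.logb]; ring
  simp only [hlog, ← Finset.sum_div]
  exact div_le_div_of_nonneg_right key (Real.log_pos one_lt_two).le

/-! ### A Fano inequality for a single test -/

theorem continuous_h2 : Continuous h2 := by
  have h : h2 = fun x : ℝ => -(x * Real.log x) / Real.log 2 -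
      (1 - x) * Real.log (1 - x) / Real.log 2 := by
    funext x
    simp only [h2, Real.logb]
    ring
  rw [h]
  exact (Real.continuous_mul_log.neg.div_const _).sub
    ((Real.continuous_mul_log.comp (continuous_const.sub continuous_id)).div_const _)

theorem isPOVM_bool {n : Type*} [Fintype n] [DecidableEq n] {T : Matrix n n ℂ}
    (hT : T.PosSemidef) (hT' : (1 - T).PosSemidef) :
    IsPOVM fun b : Bool => cond b T (1 - T) :=
  ⟨fun b => by cases b <;> assumption, by simp⟩

theorem neg_relEntropy_le_of_test {n : Type*} [Fintype n] [DecidableEq n] {ρ σ T : Matrix n n ℂ}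
    (hρ : IsState ρ) (hσ : IsState σ) (hker : ∀ v : n → ℂ, σ *ᵥ v = 0 → ρ *ᵥ v = 0)
    (hT : T.PosSemidef) (hT' : (1 - T).PosSemidef) {m : ℝ} (hm : 1 ≤ m)
    (h : (σ * T).trace.re = m⁻¹) :
    -relEntropy ρ σ ≤ -Real.logb 2 m + (1 - (ρ * T).trace.re) * Real.logb 2 (m - 1)
      + h2 (ρ * T).trace.re := by
  have key := (isPOVM_bool hT hT').sum_mul_logb_le_relEntropy hρ.1 hσ.1 hker
  have hcompl : ∀ τ : Matrix n n ℂ, IsState τ →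
      (τ * (1 - T)).trace.re = 1 - (τ * T).trace.re := fun τ hτ => by
    rw [mul_sub, mul_one, Matrix.trace_sub, hτ.2, Complex.sub_re, Complex.one_re]
  simp only [Fintype.sum_bool, cond_true, cond_false, hcompl ρ hρ, hcompl σ hσ, h] at key
  set p := (ρ * T).trace.re
  have hlog : Real.logb 2 (1 - m⁻¹) = Real.logb 2 (m - 1) - Real.logb 2 m := by
    -- At `m = 1` the identity holds because `Real.logb 2 0 = 0`.
    rcases hm.eq_or_lt with rfl | hm
    · simp
    · rw [← Real.logb_div (by linarith) (by linarith)]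
      congr 1
      field_simp
  rw [Real.logb_inv, hlog] at key
  rw [h2]
  linarith

/-! ### Tests of a bipartite state against `π_A ⊗ ρ_B` -/

section Bipartite

variable {A B : Type*} [Fintype A] [DecidableEq A] [Fintype B] [DecidableEq B]

omit [DecidableEq A] [Fintype B] [DecidableEq B] in
theorem reduceRight_posSemidef {ρ : Matrix (A × B) (A × B) ℂ} (hρ : ρ.PosSemidef) :
    (reduceRight ρ).PosSemidef := by
  have h : reduceRight ρ = ∑ a, ρ.submatrix (fun b => (a, b)) (fun b => (a, b)) := by
    ext b b'
    simp [reduceRight, Matrix.sum_apply]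
  rw [h]
  exact Matrix.posSemidef_sum _ fun a _ => hρ.submatrix _

theorem mixed_posSemidef : (mixed A).PosSemidef :=
  Matrix.PosSemidef.one.smul (by positivity)

theorem mixed_trace [Nonempty A] : (mixed A).trace = 1 := by
  simp [mixed, Matrix.trace_smul]

omit [DecidableEq A] [DecidableEq B] in
theorem IsState.nonempty_left {ρ : Matrix (A × B) (A × B) ℂ} (hρ : IsState ρ) : Nonempty A := by
  by_contra hA
  rw [not_nonempty_iff] at hA
  have h := hρ.2
  simp [Matrix.trace] at h

omit [DecidableEq B] in
theorem IsState.mixed_kronecker_reduceRight {ρ : Matrix (A × B) (A × B) ℂ} (hρ : IsState ρ) :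
    IsState (mixed A ⊗ₖ reduceRight ρ) := by
  have := hρ.nonempty_left
  refine ⟨mixed_posSemidef.kronecker (reduceRight_posSemidef hρ.1), ?_⟩
  rw [Matrix.trace_kronecker, mixed_trace, reduceRight_trace, hρ.2, one_mul]

/-- The kernel of `π_A ⊗ ρ_B` is contained in that of `ρ_{AB}`. -/
theorem mulVec_eq_zero_of_mixed_kronecker {ρ : Matrix (A × B) (A × B) ℂ} (hρ : ρ.PosSemidef)
    (v : A × B → ℂ) (hv : (mixed A ⊗ₖ reduceRight ρ) *ᵥ v = 0) : ρ *ᵥ v = 0 := by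
  -- Reshaping `v` into a matrix turns the hypothesis into `ρ_B V = 0`, hence `Tr ρ (1 ⊗ V Vᴴ) = Tr
  -- ρ_B V Vᴴ = 0`.
  set V : Matrix B A ℂ := Matrix.of fun b a => v (a, b) with hV
  have hRV : reduceRight ρ * V = 0 := by
    ext b a
    have : Nonempty A := ⟨a⟩
    have hd : (Fintype.card A : ℂ)⁻¹ ≠ 0 := by simp
    have h := congrFun hv (a, b)
    simp only [Matrix.mulVec, dotProduct, Fintype.sum_prod_type, Matrix.kroneckerMap_apply, mixed,
      Matrix.smul_apply, Matrix.one_apply, smul_eq_mul, Pi.zero_apply] at h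
    rw [Finset.sum_eq_single a (fun a' _ ha' => by simp [ha'.symm]) (by simp)] at h
    simp only [if_true, mul_one, mul_assoc, ← Finset.mul_sum] at h
    simpa [Matrix.mul_apply, hV] using (mul_eq_zero.1 h).resolve_left hd
  have h1 : ρ * ((1 : Matrix A A ℂ) ⊗ₖ V) = 0 := by
    apply mul_eq_zero_of_trace_mul_mul_conjTranspose hρ
    rw [Matrix.conjTranspose_kronecker, ← Matrix.mul_kronecker_mul, Matrix.conjTranspose_one,
      mul_one, trace_mul_one_kron, ← Matrix.mul_assoc, hRV, Matrix.zero_mul, Matrix.trace_zero]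
  funext i
  -- The columns `(a, a)` of `1 ⊗ V` add up to `v`.
  have h2 : ∑ a, (ρ * ((1 : Matrix A A ℂ) ⊗ₖ V)) i (a, a) = 0 := by simp [h1]
  simp only [Matrix.mul_apply, Fintype.sum_prod_type, Matrix.kroneckerMap_apply,
    Matrix.one_apply, ite_mul, one_mul, zero_mul, mul_ite, mul_zero] at h2
  rw [Finset.sum_comm] at h2
  simpa [Matrix.mulVec, dotProduct, Fintype.sum_prod_type, hV, Finset.sum_ite_irrel] using h2

/-- A test whose success probability on `π_A ⊗ ρ_B` is `1 / m` bounds the conditional entropy. -/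
theorem IsState.condEntropy_le_of_test {ρ T : Matrix (A × B) (A × B) ℂ} (hρ : IsState ρ)
    (hT : T.PosSemidef) (hT' : (1 - T).PosSemidef) {m : ℝ} (hm : 1 ≤ m)
    (h : ((mixed A ⊗ₖ reduceRight ρ) * T).trace.re = m⁻¹) :
    condEntropy ρ ≤ Real.logb 2 (Fintype.card A) - Real.logb 2 m
      + (1 - (ρ * T).trace.re) * Real.logb 2 (m - 1) + h2 (ρ * T).trace.re := by
  have := neg_relEntropy_le_of_test hρ hρ.mixed_kronecker_reduceRight
    (mulVec_eq_zero_of_mixed_kronecker hρ.1) hT hT' hm h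
  rw [condEntropy]
  linarith

end Bipartite

theorem re_trace_mul_le_one {n : Type*} [Fintype n] [DecidableEq n] {ρ T : Matrix n n ℂ}
    (hρ : IsState ρ) (hT' : (1 - T).PosSemidef) : (ρ * T).trace.re ≤ 1 := by
  have h := (Complex.le_def.1 (trace_mul_nonneg hρ.1 hT')).1
  rw [mul_sub, mul_one, Matrix.trace_sub, hρ.2, Complex.sub_re, Complex.one_re] at h
  exact sub_nonneg.1 h

/-- The supremum lies in the closure of `S`, so neither an optimal strategy nor monotonicity of `g`
is needed. -/
theorem le_apply_csSup {S : Set ℝ} {g : ℝ → ℝ} {c : ℝ} (hg : Continuous g) (hS : S.Nonempty)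
    (hb : BddAbove S) (h : ∀ x ∈ S, c ≤ g x) : c ≤ g (sSup S) :=
  closure_minimal (t := {x | c ≤ g x}) h (isClosed_le continuous_const hg)
    (csSup_mem_closure hS hb)

/-! ### Guessing -/

section Guessing

variable {X B : Type*} [Fintype X] [DecidableEq X] [Fintype B] [DecidableEq B]

omit [Fintype B] [DecidableEq B] in
theorem cqState_apply (p : X → ℝ) (φ : X → Matrix B B ℂ) (i j : X × B) :
    cqState p φ i j = if i.1 = j.1 then (p i.1 : ℂ) * φ i.1 i.2 j.2 else 0 := by
  simp only [cqState, Matrix.sum_apply, Matrix.smul_apply, Matrix.kroneckerMap_apply,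
    Matrix.single_apply, smul_eq_mul]
  rw [Finset.sum_eq_single i.1 (fun x _ hx => by simp [hx]) (by simp)]
  simp

omit [DecidableEq B] in
theorem cqState_posSemidef {p : X → ℝ} {φ : X → Matrix B B ℂ} (hp : ∀ x, 0 ≤ p x)
    (hφ : ∀ x, (φ x).PosSemidef) : (cqState p φ).PosSemidef := by
  refine Matrix.posSemidef_sum _ fun x _ => Matrix.PosSemidef.smul ?_ (by simpa using hp x)
  refine Matrix.PosSemidef.kronecker ?_ (hφ x)
  rw [← Matrix.diagonal_single]
  exact Matrix.PosSemidef.diagonal (Pi.single_nonneg.2 zero_le_one)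

omit [DecidableEq B] in
-- With unit weights `cqState` is the guessing test `∑ₓ |x⟩⟨x| ⊗ Λₓ`, which sees only the diagonal
-- blocks of `M`.
theorem trace_mul_cqState_one (M : Matrix (X × B) (X × B) ℂ) (Λ : X → Matrix B B ℂ) :
    (M * cqState (fun _ => 1) Λ).trace =
      ∑ x, (M.submatrix (fun b => (x, b)) (fun b => (x, b)) * Λ x).trace := by
  simp only [Matrix.trace, Matrix.diag_apply, Matrix.mul_apply, Fintype.sum_prod_type,
    cqState_apply, Matrix.submatrix_apply, Complex.ofReal_one, one_mul]
  refine Finset.sum_congr rfl fun x _ => Finset.sum_congr rfl fun b _ => ?_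
  rw [Finset.sum_eq_single x (fun y _ hy => by simp [hy]) (by simp)]
  simp

omit [DecidableEq B] in
theorem cqState_isState {p : X → ℝ} {φ : X → Matrix B B ℂ} (hp : ∀ x, 0 ≤ p x)
    (hsum : ∑ x, p x = 1) (hφ : ∀ x, IsState (φ x)) : IsState (cqState p φ) := by
  refine ⟨cqState_posSemidef hp fun x => (hφ x).1, ?_⟩
  rw [cqState, Matrix.trace_sum]
  simp only [Matrix.trace_smul, Matrix.trace_kronecker, (hφ _).2, Matrix.trace_single_eq_same,
    mul_one, smul_eq_mul]
  exact_mod_cast hsum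

omit [Fintype B] in
theorem one_sub_cqState_one (Λ : X → Matrix B B ℂ) :
    1 - cqState (fun _ => 1) Λ = cqState (fun _ => 1) fun x => 1 - Λ x := by
  ext ⟨x, b⟩ ⟨y, b'⟩
  by_cases h : x = y <;> simp [cqState_apply, Matrix.one_apply, h]

theorem IsPOVM.one_sub_posSemidef {Λ : X → Matrix B B ℂ} (hΛ : IsPOVM Λ) (x : X) :
    (1 - Λ x).PosSemidef := by
  rw [← hΛ.2, ← Finset.sum_erase_eq_sub (Finset.mem_univ x)]
  exact Matrix.posSemidef_sum _ fun y _ => hΛ.1 y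

omit [DecidableEq B] in
theorem re_trace_cqState_mul_cqState (p : X → ℝ) (φ Λ : X → Matrix B B ℂ) :
    (cqState p φ * cqState (fun _ => 1) Λ).trace.re = guessProb p φ Λ := by
  rw [trace_mul_cqState_one, Complex.re_sum, guessProb]
  refine Finset.sum_congr rfl fun x _ => ?_
  have h : (cqState p φ).submatrix (fun b => (x, b)) (fun b => (x, b)) = (p x : ℂ) • φ x := by
    ext b b'
    simp [cqState_apply]
  rw [h, Matrix.smul_mul, Matrix.trace_smul, smul_eq_mul, Complex.re_ofReal_mul]

theorem trace_mixed_kronecker_mul_cqState {Λ : X → Matrix B B ℂ} (hΛ : IsPOVM Λ)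
    {R : Matrix B B ℂ} (hR : R.trace = 1) :
    ((mixed X ⊗ₖ R) * cqState (fun _ => 1) Λ).trace = (Fintype.card X : ℂ)⁻¹ := by
  have h : ∀ x : X, (mixed X ⊗ₖ R).submatrix (fun b => (x, b)) (fun b => (x, b)) =
      (Fintype.card X : ℂ)⁻¹ • R := by
    intro x
    ext b b'
    simp [mixed]
  simp only [trace_mul_cqState_one, h]
  rw [← Matrix.trace_sum, ← Finset.mul_sum, hΛ.2, mul_one, Matrix.trace_smul, hR, smul_eq_mul,
    mul_one]

omit [DecidableEq X] in
theorem exists_isPOVM [Nonempty X] : ∃ Λ : X → Matrix B B ℂ, IsPOVM Λ := by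
  refine ⟨fun _ => (Fintype.card X : ℂ)⁻¹ • 1,
    fun _ => Matrix.PosSemidef.one.smul (by positivity), ?_⟩
  rw [Finset.sum_const, Finset.card_univ, ← Nat.cast_smul_eq_nsmul ℂ, smul_smul,
    mul_inv_cancel₀ (by simp), one_smul]

/-- **Fano inequality for guessing.** -/
theorem condEntropy_cqState_le {p : X → ℝ} {φ : X → Matrix B B ℂ} (hp : ∀ x, 0 ≤ p x)
    (hsum : ∑ x, p x = 1) (hφ : ∀ x, IsState (φ x)) :
    condEntropy (cqState p φ) ≤
      (1 - guessProbOpt p φ) * Real.logb 2 ((Fintype.card X : ℝ) - 1)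
        + h2 (guessProbOpt p φ) := by
  have hρ := cqState_isState hp hsum hφ
  have hX : Nonempty X := hρ.nonempty_left
  have hT : ∀ Λ : X → Matrix B B ℂ, IsPOVM Λ → (cqState (fun _ => 1) Λ).PosSemidef :=
    fun Λ hΛ => cqState_posSemidef (fun _ => zero_le_one) hΛ.1
  have hT' : ∀ Λ : X → Matrix B B ℂ, IsPOVM Λ → (1 - cqState (fun _ => 1) Λ).PosSemidef :=
    fun Λ hΛ => by
      rw [one_sub_cqState_one]
      exact cqState_posSemidef (fun _ => zero_le_one) hΛ.one_sub_posSemidef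
  refine le_apply_csSup (g := fun x => (1 - x) * Real.logb 2 ((Fintype.card X : ℝ) - 1) + h2 x)
    (((continuous_const.sub continuous_id).mul_const _).add continuous_h2) ?_ ⟨1, ?_⟩ ?_
  · obtain ⟨Λ, hΛ⟩ := exists_isPOVM (X := X) (B := B)
    exact ⟨_, Λ, hΛ, rfl⟩
  · rintro _ ⟨Λ, hΛ, rfl⟩
    rw [← re_trace_cqState_mul_cqState]
    exact re_trace_mul_le_one hρ (hT' Λ hΛ)
  · rintro _ ⟨Λ, hΛ, rfl⟩
    -- For this `m` the terms `log |X|` and `log m` cancel.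
    have h := hρ.condEntropy_le_of_test (hT Λ hΛ) (hT' Λ hΛ) (m := Fintype.card X)
      (by exact_mod_cast Fintype.card_pos) (by
        rw [trace_mixed_kronecker_mul_cqState hΛ (by rw [reduceRight_trace, hρ.2])]
        simp)
    rw [re_trace_cqState_mul_cqState] at h
    linarith

end Guessing

/-! ### Entanglement recovery -/

section Recovery

theorem exists_trace_mul_eq {n : Type*} [Fintype n] [DecidableEq n]
    (L : Matrix n n ℂ →ₗ[ℂ] ℂ) : ∃ T : Matrix n n ℂ, ∀ M, L M = (M * T).trace := by
  refine ⟨Matrix.of fun i j => L (Matrix.single j i 1), fun M => ?_⟩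
  conv_lhs => rw [Matrix.matrix_eq_sum_single M]
  simp only [map_sum, Matrix.trace, Matrix.diag_apply, Matrix.mul_apply, Matrix.of_apply]
  refine Finset.sum_congr rfl fun i _ => Finset.sum_congr rfl fun j _ => ?_
  rw [← smul_eq_mul, ← map_smul, Matrix.smul_single, smul_eq_mul, mul_one]

/-- The trace is `⟨v, T v⟩`. Nonnegativity in `ℂ` includes being real, so `T` is automatically
Hermitian. -/
theorem posSemidef_of_trace_vecMulVec_mul_nonneg {n : Type*} [Fintype n] [DecidableEq n]
    {T : Matrix n n ℂ} (h : ∀ v : n → ℂ, 0 ≤ (Matrix.vecMulVec v (star v) * T).trace) :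
    T.PosSemidef := by
  rw [← Matrix.isPositive_toEuclideanLin_iff, LinearMap.isPositive_iff_complex]
  intro v
  have h1 : inner ℂ (Matrix.toEuclideanLin T v) v = star (star v.ofLp ⬝ᵥ (T *ᵥ v.ofLp)) := by
    rw [EuclideanSpace.inner_eq_star_dotProduct, Matrix.star_dotProduct, star_star,
      dotProduct_comm]
    rfl
  have h2 := h v.ofLp
  rw [Matrix.vecMulVec_mul, Matrix.trace_vecMulVec, dotProduct_comm,
    ← Matrix.dotProduct_mulVec] at h2
  rw [h1]
  have h3 := Complex.le_def.1 h2
  refine ⟨Complex.ext (by simp) ?_, ?_⟩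
  · simpa using h3.2.symm
  · simpa using h3.1

variable {K A B C : Type*}

/-- `applyRight` as a linear map in the bipartite matrix. -/
def applyRightLinear (K : Type*) (E : Matrix B B ℂ →ₗ[ℂ] Matrix C C ℂ) :
    Matrix (K × B) (K × B) ℂ →ₗ[ℂ] Matrix (K × C) (K × C) ℂ where
  toFun := applyRight E
  map_add' M N := by
    ext i j
    exact congrFun (congrFun (map_add E (Matrix.of fun b b' => M (i.1, b) (j.1, b'))
      (Matrix.of fun b b' => N (i.1, b) (j.1, b'))) i.2) j.2
  map_smul' c M := by
    ext i j
    exact congrFun (congrFun (map_smul E c (Matrix.of fun b b' => M (i.1, b) (j.1, b'))) i.2) j.2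

theorem applyRight_kronecker (E : Matrix B B ℂ →ₗ[ℂ] Matrix C C ℂ) (M : Matrix K K ℂ)
    (R : Matrix B B ℂ) : applyRight E (M ⊗ₖ R) = M ⊗ₖ E R := by
  ext i j
  exact congrFun (congrFun (map_smul E (M i.1 j.1) R) i.2) j.2

variable [Fintype K] [Fintype A] [DecidableEq A] [Fintype B] [Fintype C]

/-- Complete positivity is stated for ancillas `Fin k`; relabelling extends it to any finite `K`. -/
theorem IsChannel.applyRight_posSemidef {E : Matrix B B ℂ →ₗ[ℂ] Matrix C C ℂ} (hE : IsChannel E)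
    {M : Matrix (K × B) (K × B) ℂ} (hM : M.PosSemidef) : (applyRight E M).PosSemidef := by
  let e := Fintype.equivFin K
  have h := hE.1 _ _ (hM.submatrix (Prod.map e.symm id))
  have h1 := h.submatrix (Prod.map e id)
  have h2 : (applyRight E (M.submatrix (Prod.map e.symm id) (Prod.map e.symm id))).submatrix
      (Prod.map e id) (Prod.map e id) = applyRight E M := by
    ext i j
    simp [applyRight]
  rwa [h2] at h1

theorem IsChannel.trace_applyRight {E : Matrix B B ℂ →ₗ[ℂ] Matrix C C ℂ} (hE : IsChannel E)
    (M : Matrix (K × B) (K × B) ℂ) : (applyRight E M).trace = M.trace := by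
  simp only [Matrix.trace, Matrix.diag_apply, Fintype.sum_prod_type]
  exact Finset.sum_congr rfl fun k _ => hE.2 (Matrix.of fun b b' => M (k, b) (k, b'))

theorem maxEntVec_dotProduct_star [Nonempty A] : maxEntVec A ⬝ᵥ star (maxEntVec A) = 1 := by
  have h0 : (0 : ℝ) ≤ Fintype.card A := by positivity
  have h : ∀ a : A, ∑ a', maxEntVec A (a, a') * star (maxEntVec A (a, a')) =
      ((Fintype.card A : ℝ)⁻¹ : ℝ) := by
    intro a
    rw [Finset.sum_eq_single a (fun a' _ ha' => by simp [maxEntVec, ha'.symm]) (by simp)]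
    simp only [maxEntVec, if_true, Complex.star_def, Complex.conj_ofReal, ← Complex.ofReal_mul]
    rw [← mul_inv, Real.mul_self_sqrt h0]
  simp only [dotProduct, Fintype.sum_prod_type, Pi.star_apply, h]
  simp

theorem one_sub_maxEnt_posSemidef [Nonempty A] : (1 - maxEnt A).PosSemidef := by
  have hh : (maxEnt A)ᴴ = maxEnt A := (Matrix.posSemidef_vecMulVec_self_star _).1
  have h : maxEnt A * maxEnt A = maxEnt A := by
    rw [maxEnt, Matrix.vecMulVec_mul_vecMulVec, dotProduct_comm, maxEntVec_dotProduct_star]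
    simp
  have h1 : 1 - maxEnt A = (1 - maxEnt A)ᴴ * (1 - maxEnt A) := by
    rw [Matrix.conjTranspose_sub, Matrix.conjTranspose_one, hh, sub_mul, mul_sub, mul_sub, h]
    simp
  rw [h1]
  exact Matrix.posSemidef_conjTranspose_mul_self _

theorem reduceRight_maxEnt : reduceRight (maxEnt A) = mixed A := by
  have h0 : (0 : ℝ) ≤ Fintype.card A := by positivity
  ext a a'
  simp only [reduceRight, maxEnt, Matrix.of_apply, Matrix.vecMulVec_apply, Pi.star_apply, mixed,
    Matrix.smul_apply, Matrix.one_apply, smul_eq_mul]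
  rw [Finset.sum_eq_single a (fun x _ hx => by simp [maxEntVec, hx]) (by simp)]
  by_cases h : a = a'
  · simp only [maxEntVec, h, if_true, Complex.star_def, Complex.conj_ofReal, ← Complex.ofReal_mul]
    rw [← mul_inv, Real.mul_self_sqrt h0]
    simp
  · simp [maxEntVec, h]

/-- One factor `1/|A|` comes from `π_A`, the other from the maximally mixed marginal of `Φ`. -/
theorem trace_maxEnt_mul_mixed_kronecker (N : Matrix A A ℂ) :
    (maxEnt A * (mixed A ⊗ₖ N)).trace = ((Fintype.card A : ℂ) ^ 2)⁻¹ * N.trace := by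
  rw [mixed, Matrix.smul_kronecker, Matrix.mul_smul, Matrix.trace_smul, trace_mul_one_kron,
    reduceRight_maxEnt, mixed, Matrix.smul_mul, one_mul, Matrix.trace_smul]
  simp only [smul_eq_mul]
  ring

/-- The fidelity test `Tr[Φ (id ⊗ E)(·)]` pulled back through a channel `E` is an effect. -/
theorem IsChannel.exists_effect [DecidableEq B] [Nonempty A]
    {E : Matrix B B ℂ →ₗ[ℂ] Matrix A A ℂ}
    (hE : IsChannel E) : ∃ T : Matrix (A × B) (A × B) ℂ, T.PosSemidef ∧ (1 - T).PosSemidef ∧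
      ∀ M, (maxEnt A * applyRight E M).trace = (M * T).trace := by
  obtain ⟨T, hT⟩ := exists_trace_mul_eq (Matrix.traceLinearMap (A × A) ℂ ℂ ∘ₗ
    LinearMap.mulLeft ℂ (maxEnt A) ∘ₗ applyRightLinear A E)
  replace hT : ∀ M, (maxEnt A * applyRight E M).trace = (M * T).trace := hT
  have hv : ∀ v : A × B → ℂ, (applyRight E (Matrix.vecMulVec v (star v))).PosSemidef := fun v =>
    hE.applyRight_posSemidef (Matrix.posSemidef_vecMulVec_self_star v)
  refine ⟨T, posSemidef_of_trace_vecMulVec_mul_nonneg fun v => ?_,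
    posSemidef_of_trace_vecMulVec_mul_nonneg fun v => ?_, hT⟩
  · rw [← hT]
    exact trace_mul_nonneg (Matrix.posSemidef_vecMulVec_self_star _) (hv v)
  -- Trace preservation identifies `Tr[(1 - Φ)(id ⊗ E)(vvᴴ)]` with `Tr[vvᴴ (1 - T)]`.
  · have h := trace_mul_nonneg one_sub_maxEnt_posSemidef (hv v)
    rwa [sub_mul, one_mul, Matrix.trace_sub, hT, hE.trace_applyRight, ← Matrix.trace_sub,
      ← mul_one_sub] at h

/-- The channel discarding its input and preparing `π_A` makes the set of recovery fidelities
nonempty. -/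
theorem exists_isChannel [Nonempty A] :
    ∃ E : Matrix B B ℂ →ₗ[ℂ] Matrix A A ℂ, IsChannel E := by
  refine ⟨(Matrix.traceLinearMap B ℂ ℂ).smulRight (mixed A), fun k M hM => ?_, fun M => ?_⟩
  · have h : applyRight ((Matrix.traceLinearMap B ℂ ℂ).smulRight (mixed A)) M =
        (∑ b, M.submatrix (fun x => (x, b)) (fun x => (x, b))) ⊗ₖ mixed A := by
      ext i j
      simp [applyRight, Matrix.trace, Matrix.sum_apply]
    rw [h]
    exact (Matrix.posSemidef_sum _ fun b _ => hM.submatrix _).kronecker mixed_posSemidef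
  · simp [Matrix.trace_smul, mixed_trace]

/-- **Fano inequality for entanglement recovery.** -/
theorem IsState.condEntropy_le_recoveryOpt [DecidableEq B] {ρ : Matrix (A × B) (A × B) ℂ}
    (hρ : IsState ρ) :
    condEntropy ρ ≤ -Real.logb 2 (Fintype.card A)
      + (1 - recoveryOpt ρ) * Real.logb 2 ((Fintype.card A : ℝ) ^ 2 - 1)
      + h2 (recoveryOpt ρ) := by
  have hA : Nonempty A := hρ.nonempty_left
  refine le_apply_csSup (g := fun x => -Real.logb 2 (Fintype.card A)
      + (1 - x) * Real.logb 2 ((Fintype.card A : ℝ) ^ 2 - 1) + h2 x)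
    ((continuous_const.add ((continuous_const.sub continuous_id).mul_const _)).add
      continuous_h2) ?_ ⟨1, ?_⟩ ?_
  · obtain ⟨E, hE⟩ := exists_isChannel (A := A) (B := B)
    exact ⟨_, E, hE, rfl⟩
  · rintro _ ⟨E, hE, rfl⟩
    obtain ⟨T, -, hT', h⟩ := hE.exists_effect
    rw [recovery, h]
    exact re_trace_mul_le_one hρ hT'
  · rintro _ ⟨E, hE, rfl⟩
    obtain ⟨T, hT, hT', h⟩ := hE.exists_effect
    have hc : (1 : ℝ) ≤ Fintype.card A := by exact_mod_cast Fintype.card_pos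
    -- On `π_A ⊗ ρ_B` every channel has fidelity `|A|⁻²`; then `log |A| - log m = -log |A|`.
    have key := hρ.condEntropy_le_of_test hT hT' (m := (Fintype.card A : ℝ) ^ 2)
      (one_le_pow₀ hc) (by
        rw [← h, applyRight_kronecker, trace_maxEnt_mul_mixed_kronecker, hE.2,
          reduceRight_trace, hρ.2, mul_one, ← Complex.ofReal_natCast, ← Complex.ofReal_pow, ← Complex.ofReal_inv,
          Complex.ofReal_re])
    rw [← h, Real.logb_pow] at key
    simp only [recovery]
    push_cast at key
    linarith

end Recovery

end QInfo

theorem mainTheorem7 {X A B : Type*} [Fintype X] [DecidableEq X] [Fintype A] [DecidableEq A]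
    [Fintype B] [DecidableEq B] :
    (∀ (p : X → ℝ) (φ : X → Matrix B B ℂ),
      (∀ x, 0 ≤ p x) → ∑ x, p x = 1 → (∀ x, QInfo.IsState (φ x)) →
      QInfo.condEntropy (QInfo.cqState p φ) ≤
        (1 - QInfo.guessProbOpt p φ) * Real.logb 2 ((Fintype.card X : ℝ) - 1)
          + QInfo.h2 (QInfo.guessProbOpt p φ)) ∧
    (∀ ρ : Matrix (A × B) (A × B) ℂ, QInfo.IsState ρ →
      QInfo.condEntropy ρ ≤
        -Real.logb 2 (Fintype.card A)
          + (1 - QInfo.recoveryOpt ρ) * Real.logb 2 ((Fintype.card A : ℝ) ^ 2 - 1)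
          + QInfo.h2 (QInfo.recoveryOpt ρ)) := by
  exact ⟨fun p φ hp hsum hφ => QInfo.condEntropy_cqState_le hp hsum hφ,
    fun ρ hρ => hρ.condEntropy_le_recoveryOpt⟩
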